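/- Let $n\in\{2,3\}$ and let $\Omega\subset\mathbb R^n$ be open, bounded and convex. Let $a_0\in L^\infty(\Omega)$ with $a_0\ge 0$ a.e., let $a_{ij}=a_{ji}\in C^{0,1}(\bar\Omega)$ ($1\le i,j\le n$), and suppose that there is $\alpha>0$ with $\sum_{i,j}a_{ij}(x)\xi_i\xi_j\ge\alpha|\xi|^2$ for all $x\in\Omega$, $\xi\in\mathbb R^n$. Put $$a(z,v)=\sum_{i,j=1}^n\int_\Omega a_{ij}\,\partial_{x_i}z\,\partial_{x_j}v\,dx+\int_\Omega a_0zv\,dx$$ with weak derivatives. Let $T_h$ be a finite conforming triangulation by closed $n$-simplices contained in $\bar\Omega$, let $\Omega_h$ be the interior of the union of these simplices, and let $$V_h=\{v_h\in C_0(\Omega): v_h|_T \text{ is affine for every } T\in T_h,\ v_h=0 \text{ on } \Omega\setminus\Omega_h\},$$ where $C_0(\Omega)$ denotes the continuous functions on $\bar\Omega$ that vanish on $\partial\Omega$. Let $S_h:L^2(\Omega)\to V_h$ be the Galerkin operator: $S_h\eta$ is the element $y_h\in V_h$ with $a(y_h,v_h)=(\eta,v_h)_{L^2(\Omega)}$ for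 all $v_h\in V_h$. Let $\Gamma_\sigma\subset\Omega$ be a Lipschitz hypersurface of finite area or, more generally, any measurable set with finite $(n-1)$-dimensional Hausdorff measure, and let $L^2(\Gamma_\sigma)$ be taken with respect to that measure. Let $m_\sigma$ be any inner product on the real vector space $L^2(\Gamma_\sigma)$, with norm $\|w\|_{\Gamma_\sigma}=\sqrt{m_\sigma(w,w)}$, and let $g_{\Gamma,\sigma}\in L^2(\Gamma_\sigma)$. Let $\nu>0$, let either $a,b\in\mathbb R$ with $a<b$, or $a=-\infty$ and $b=\infty$, and let $U_{ad}=\{\eta\in L^2(\Omega): a\le\eta\le b \text{ a.e. in }\Omega\}$. Consider the discrete problem $$\min_{\eta\in U_{ad}}\hat J_h(\eta),\qquad \hat J_h(\eta)=\tfrac12\|S_h\eta|_{\Gamma_\sigma}-g_{\Gamma,\sigma}\|_{\Gamma_\sigma}^2+\tfrac\nu2\|\eta\|_{L^2(\Omega)}^2 .$$ Then $V_h\subset H^1(\Omega)$ and $S_h$ is well defined (for every $\eta\in L^2(\Omega)$ exactly one such $y_h$ exists), and the discrete problem has a unique solution $u_h\in U_{ad}$. Moreover, $u_h\in L^2(\Omega)$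 is a solution of the discrete problem if and only if there is $p_h\in V_h$ such that $$u_h\in U_{ad},\qquad (p_h+\nu u_h,\,v-u_h)_{L^2(\Omega)}\ge 0\quad\text{for all } v\in U_{ad},$$ $$a(v_h,p_h)=m_\sigma\big(S_hu_h|_{\Gamma_\sigma}-g_{\Gamma,\sigma},\,v_h|_{\Gamma_\sigma}\big)\quad\text{for all } v_h\in V_h .$$ -/

import Mathlib

open MeasureTheory Set
open scoped ContDiff MeasureTheory

noncomputable section

namespace SurfaceControl

/-- `ℝⁿ` with the Euclidean norm. -/
abbrev Space (n : ℕ) : Type := EuclideanSpace ℝ (Fin n)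

/-- `g` is the weak partial derivative `∂ᵢ u` of `u` in the open set `Ω`. -/
def HasWeakPartialDeriv {n : ℕ} (Ω : Set (Space n)) (i : Fin n) (u g : Space n → ℝ) : Prop :=
  LocallyIntegrableOn u Ω volume ∧ LocallyIntegrableOn g Ω volume ∧
    ∀ φ : Space n → ℝ, ContDiff ℝ ∞ φ → HasCompactSupport φ → tsupport φ ⊆ Ω →
      ∫ x in Ω, u x * fderiv ℝ φ x (EuclideanSpace.single i 1) = - ∫ x in Ω, g x * φ x

/-- `u ∈ H¹(Ω)`: `u` and its weak first order derivatives are square integrable over `Ω`. -/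
def MemH1 {n : ℕ} (Ω : Set (Space n)) (u : Space n → ℝ) : Prop :=
  MemLp u 2 (volume.restrict Ω) ∧
    ∀ i : Fin n, ∃ g : Space n → ℝ,
      MemLp g 2 (volume.restrict Ω) ∧ HasWeakPartialDeriv Ω i u g

open Classical in
/-- The weak partial derivative `∂ᵢ u` in `Ω` (unique up to null sets when it exists, which is the
case for every `u ∈ H¹(Ω)`; `0` by convention if it does not exist). -/
def weakPartial {n : ℕ} (Ω : Set (Space n)) (i : Fin n) (u : Space n → ℝ) : Space n → ℝ :=
  if h : ∃ g : Space n → ℝ, HasWeakPartialDeriv Ω i u g then h.choose else 0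

/-- The bilinear form
`a(z, v) = ∑ᵢⱼ ∫_Ω aᵢⱼ ∂ᵢz ∂ⱼv dx + ∫_Ω a₀ z v dx`, with weak derivatives. -/
def ellipticForm {n : ℕ} (Ω : Set (Space n)) (A : Fin n → Fin n → Space n → ℝ)
    (a₀ : Space n → ℝ) (z v : Space n → ℝ) : ℝ :=
  (∑ i, ∑ j, ∫ x in Ω, A i j x * weakPartial Ω i z x * weakPartial Ω j v x) +
    ∫ x in Ω, a₀ x * z x * v x

/-- The standing assumptions on the coefficients of the elliptic operator: `a₀ ∈ L^∞(Ω)` is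
nonnegative, the `aᵢⱼ = aⱼᵢ` are Lipschitz on the closure of `Ω`, and the principal part is
uniformly elliptic. -/
structure IsEllipticCoeff {n : ℕ} (Ω : Set (Space n)) (A : Fin n → Fin n → Space n → ℝ)
    (a₀ : Space n → ℝ) : Prop where
  memLp_zero : MemLp a₀ ⊤ (volume.restrict Ω)
  nonneg_zero : ∀ᵐ x ∂(volume.restrict Ω), 0 ≤ a₀ x
  symm : ∀ i j, ∀ x ∈ closure Ω, A i j x = A j i x
  lipschitz : ∀ i j, ∃ C : NNReal, LipschitzOnWith C (A i j) (closure Ω)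
  elliptic : ∃ α : ℝ, 0 < α ∧ ∀ x ∈ Ω, ∀ ξ : Space n,
    α * ‖ξ‖ ^ 2 ≤ ∑ i, ∑ j, A i j x * ξ i * ξ j

/-- `K` is a (finite, conforming) triangulation of a polyhedral set contained in the closure of
`Ω`. Its elements are the closed simplices spanned by the faces with `n + 1` vertices; conformity
is part of Mathlib's notion of a simplicial complex. -/
structure IsTriangulation {n : ℕ} (Ω : Set (Space n))
    (K : Geometry.SimplicialComplex ℝ (Space n)) : Prop where
  finite : K.faces.Finite
  pure : ∀ s ∈ K.faces, ∃ t ∈ K.faces, s ⊆ t ∧ t.card = n + 1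
  space_subset : K.space ⊆ closure Ω

/-- The polyhedral domain `Ω_h` covered by the triangulation. -/
def polyDomain {n : ℕ} (K : Geometry.SimplicialComplex ℝ (Space n)) : Set (Space n) :=
  interior K.space

/-- The finite element space `V_h` of the functions in `C₀(Ω)` that are affine on every element of
the triangulation and vanish on `Ω \ Ω_h`. A function in `C₀(Ω)` (continuous on the closure of `Ω`,
zero on the boundary) is identified with its extension by zero, that is, with a continuous function
on `ℝⁿ` that vanishes outside `Ω`. -/
def feSpace {n : ℕ} (Ω : Set (Space n)) (K : Geometry.SimplicialComplex ℝ (Space n)) :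
    Submodule ℝ (Space n → ℝ) where
  carrier := {v | Continuous v ∧ (∀ x, x ∉ Ω → v x = 0) ∧
    (∀ x ∈ Ω \ polyDomain K, v x = 0) ∧
    ∀ t ∈ K.faces, t.card = n + 1 →
      ∃ f : Space n →ᵃ[ℝ] ℝ, EqOn v f (convexHull ℝ (t : Set (Space n)))}
  add_mem' := by
    rintro v w ⟨hv, hv0, hv1, hv2⟩ ⟨hw, hw0, hw1, hw2⟩
    refine ⟨hv.add hw, fun x hx => by simp [hv0 x hx, hw0 x hx],
      fun x hx => by simp [hv1 x hx, hw1 x hx], fun t ht htc => ?_⟩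
    obtain ⟨f, hf⟩ := hv2 t ht htc
    obtain ⟨g, hg⟩ := hw2 t ht htc
    exact ⟨f + g, fun x hx => by simp [hf hx, hg hx]⟩
  zero_mem' := ⟨continuous_const, fun _ _ => rfl, fun _ _ => rfl, fun _ _ _ => ⟨0, fun _ _ => rfl⟩⟩
  smul_mem' := by
    rintro c v ⟨hv, hv0, hv1, hv2⟩
    refine ⟨hv.const_smul c, fun x hx => by simp [hv0 x hx],
      fun x hx => by simp [hv1 x hx], fun t ht htc => ?_⟩
    obtain ⟨f, hf⟩ := hv2 t ht htc
    exact ⟨c • f, fun x hx => by simp [hf hx]⟩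

/-- `L²(Ω)`. -/
abbrev L2 {n : ℕ} (Ω : Set (Space n)) : Type := Lp ℝ 2 (volume.restrict Ω)

/-- The surface measure: the `(n-1)`-dimensional Hausdorff measure restricted to `Γ`. -/
abbrev surfaceMeasure {n : ℕ} (Γ : Set (Space n)) : Measure (Space n) :=
  (Measure.hausdorffMeasure ((n : ℝ) - 1)).restrict Γ

/-- `L²(Γ)` with respect to the surface measure. -/
abbrev L2Surface {n : ℕ} (Γ : Set (Space n)) : Type := Lp ℝ 2 (surfaceMeasure Γ)

/-- Finite element functions are bounded and continuous, hence square integrable over a surface of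
finite area. -/
theorem memLp_surface {n : ℕ} {Ω : Set (Space n)} (hΩ : Bornology.IsBounded Ω)
    {K : Geometry.SimplicialComplex ℝ (Space n)} {Γ : Set (Space n)}
    (hΓ : Measure.hausdorffMeasure ((n : ℝ) - 1) Γ ≠ ⊤) (v : feSpace Ω K) :
    MemLp (v : Space n → ℝ) 2 (surfaceMeasure Γ) := by
  obtain ⟨v, hv, hv0, -, -⟩ := v
  have : IsFiniteMeasure (surfaceMeasure Γ) := ⟨by simpa using hΓ.lt_top⟩
  obtain ⟨C, hC⟩ := (hΩ.isCompact_closure).exists_bound_of_continuousOn hv.continuousOn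
  refine MemLp.of_bound hv.aestronglyMeasurable (max C 0) (Filter.Eventually.of_forall fun x => ?_)
  by_cases hx : x ∈ Ω
  · exact (hC x (subset_closure hx)).trans (le_max_left _ _)
  · simp [hv0 x hx]

/-- The restriction `v_h ↦ v_h|_Γ` from `V_h` to `L²(Γ)`. -/
def surfaceRestrict {n : ℕ} {Ω : Set (Space n)} (hΩ : Bornology.IsBounded Ω)
    (K : Geometry.SimplicialComplex ℝ (Space n)) {Γ : Set (Space n)}
    (hΓ : Measure.hausdorffMeasure ((n : ℝ) - 1) Γ ≠ ⊤) : feSpace Ω K →ₗ[ℝ] L2Surface Γ where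
  toFun v := (memLp_surface hΩ hΓ v).toLp (v : Space n → ℝ)
  map_add' _ _ := rfl
  map_smul' _ _ := rfl

/-- `y ∈ V_h` solves the Galerkin equations `a(y, v_h) = (η, v_h)_{L²(Ω)}` for all `v_h ∈ V_h`. -/
def IsDiscreteState {n : ℕ} (Ω : Set (Space n)) (A : Fin n → Fin n → Space n → ℝ)
    (a₀ : Space n → ℝ) (K : Geometry.SimplicialComplex ℝ (Space n)) (η : L2 Ω)
    (y : feSpace Ω K) : Prop :=
  ∀ v : feSpace Ω K,
    ellipticForm Ω A a₀ (y : Space n → ℝ) (v : Space n → ℝ) =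
      ∫ x in Ω, η x * (v : Space n → ℝ) x

/-- The discrete control-to-state (Galerkin) operator `S_h : L²(Ω) → V_h`, sending `η` to the
solution of the Galerkin equations with right-hand side `η`. -/
def discreteSolution {n : ℕ} (Ω : Set (Space n)) (A : Fin n → Fin n → Space n → ℝ)
    (a₀ : Space n → ℝ) (K : Geometry.SimplicialComplex ℝ (Space n)) (η : L2 Ω) : feSpace Ω K :=
  Classical.epsilon fun y => IsDiscreteState Ω A a₀ K η y

/-- The set `U_ad` of the controls `η ∈ L²(Ω)` with `a ≤ η ≤ b` a.e. in `Ω`; the bounds may be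
infinite. -/
def admissible {n : ℕ} (Ω : Set (Space n)) (a b : EReal) : Set (L2 Ω) :=
  {η | ∀ᵐ x ∂(volume.restrict Ω), a ≤ ((η x : ℝ) : EReal) ∧ ((η x : ℝ) : EReal) ≤ b}

/-- `m` is an inner product on the real vector space `X` (no relation to a norm or topology on `X`
is required). -/
structure IsInnerProduct {X : Type*} [AddCommGroup X] [Module ℝ X] (m : X →ₗ[ℝ] X →ₗ[ℝ] ℝ) :
    Prop where
  symm : ∀ w z, m w z = m z w
  pos : ∀ w, w ≠ 0 → 0 < m w w

/-- The norm `√(m(w, w))` induced by an inner product. -/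
def formNorm {X : Type*} [AddCommGroup X] [Module ℝ X] (m : X →ₗ[ℝ] X →ₗ[ℝ] ℝ) (w : X) : ℝ :=
  Real.sqrt (m w w)

/-- The discrete reduced objective functional
`Ĵ_h(η) = ½ ‖S_h η - g‖²_Γ + (ν/2) ‖η‖²_{L²(Ω)}`, where `‖·‖_Γ` is the norm induced by `m`. -/
def objective {n : ℕ} {Ω : Set (Space n)} (hΩ : Bornology.IsBounded Ω)
    (A : Fin n → Fin n → Space n → ℝ) (a₀ : Space n → ℝ)
    (K : Geometry.SimplicialComplex ℝ (Space n)) {Γ : Set (Space n)}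
    (hΓ : Measure.hausdorffMeasure ((n : ℝ) - 1) Γ ≠ ⊤)
    (m : L2Surface Γ →ₗ[ℝ] L2Surface Γ →ₗ[ℝ] ℝ) (g : L2Surface Γ) (ν : ℝ) (η : L2 Ω) : ℝ :=
  1 / 2 * formNorm m (surfaceRestrict hΩ K hΓ (discreteSolution Ω A a₀ K η) - g) ^ 2 +
    ν / 2 * ‖η‖ ^ 2

/-- `u` solves the problem of minimising `J` over `U`. -/
def IsMinimiser {X : Type*} (J : X → ℝ) (U : Set X) (u : X) : Prop :=
  u ∈ U ∧ ∀ η ∈ U, J u ≤ J η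

end SurfaceControl

end

/-! A function in `V_h` is affine on finitely many simplices and zero elsewhere, hence globally
Lipschitz with compact support. Its line derivatives are therefore its weak derivatives, and `V_h`
lies in H¹. Nodal values determine such a function, so `V_h` is finite-dimensional. On it the form
is symmetric and positive definite: ellipticity turns a(v,v) = 0 into a vanishing partial
derivative, and compact support then gives v = 0. An injective map onto a dual of equal dimension
makes `S_h` well defined (`feForm_pos`, `existsUnique_of_posDef`).

The rest is an abstract quadratic control problem. Every functional of `S_h η` has the form (η, ι
z), so the objective is continuous in η although `m` need not be continuous on L²(Γ). The term in ν
makes it uniformly midpoint convex, so minimising sequences are Cauchy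
(`existsUnique_optimal_control`). The derivative at u, rewritten with the adjoint state p, is (p +
νu, ·), which gives the variational inequality (`optimal_control_iff`). -/

open Filter Topology

/-! ### Gluing Lipschitz functions -/

/-- A continuous function that is Lipschitz on each member of a finite closed cover of a normed
space is Lipschitz. -/
theorem lipschitzWith_of_finite_closed_cover {E : Type*} [NormedAddCommGroup E] [NormedSpace ℝ E]
    {F : E → ℝ} (hF : Continuous F) {𝒮 : Set (Set E)} (hfin : 𝒮.Finite) (hcover : ⋃₀ 𝒮 = univ)
    (hclosed : ∀ s ∈ 𝒮, IsClosed s) (hlip : ∀ s ∈ 𝒮, ∃ C, LipschitzOnWith C F s) :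
    ∃ C, LipschitzWith C F := by
  choose! c hc using hlip
  set C := hfin.toFinset.sup c
  have hlip : ∀ s ∈ 𝒮, LipschitzOnWith C F s := fun s hs =>
    (hc s hs).weaken (Finset.le_sup (hfin.mem_toFinset.2 hs))
  refine ⟨C, ?_⟩
  refine LipschitzWith.of_le_add_mul C fun y x => ?_
  let γ : ℝ → E := fun t => x + t • (y - x)
  have hγ : Continuous γ := by fun_prop
  -- Along the segment from x to y, a bound on the lower right slopes by `C * dist y x` integrates
  -- to the Lipschitz estimate; no differentiability is needed.
  have key := image_le_of_liminf_slope_right_le_deriv_boundary (f := F ∘ γ) (a := 0) (b := 1)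
    (hF.comp hγ).continuousOn (B := fun t => F x + (C * dist y x) * t)
    (B' := fun _ => C * dist y x) (by simp [γ]) (by fun_prop)
    (fun t _ => by
      simpa using (((hasDerivAt_id t).const_mul (C * dist y x)).const_add (F x)).hasDerivWithinAt)
    (fun t _ r hr => ?_) (right_mem_Icc.2 zero_le_one)
  · simpa [γ] using key
  -- By finiteness one member of the cover is met at times arbitrarily close to t from the right.
  -- Being closed it also contains `γ t`, so its Lipschitz bound controls these difference
  -- quotients.
  · obtain ⟨s, hs, hfreq⟩ : ∃ s ∈ 𝒮, ∃ᶠ z in 𝓝[>] t, γ z ∈ s := by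
      by_contra! h
      have h' : ∀ᶠ z in 𝓝[>] t, ∀ s ∈ 𝒮, γ z ∉ s :=
        (hfin.eventually_all).2 fun s hs => h s hs
      obtain ⟨z, hz⟩ := h'.exists
      obtain ⟨s, hs, hzs⟩ := mem_sUnion.1 (hcover ▸ mem_univ (γ z))
      exact hz s hs hzs
    have ht : γ t ∈ s := by
      have hcl : IsClosed (γ ⁻¹' s) := (hclosed s hs).preimage hγ
      exact hcl.mem_of_frequently_of_tendsto hfreq (tendsto_id.mono_left nhdsWithin_le_nhds)
    refine (hfreq.and_eventually self_mem_nhdsWithin).mono fun z ⟨hz, htz⟩ => ?_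
    refine lt_of_le_of_lt ?_ hr
    have htz' : 0 < z - t := sub_pos.2 htz
    rw [slope_def_field, div_le_iff₀ htz']
    have h1 := (hlip s hs).dist_le_mul _ hz _ ht
    have h2 : dist (γ z) (γ t) = (z - t) * dist y x := by
      simp only [γ, dist_add_left]
      rw [dist_eq_norm, ← sub_smul, norm_smul, Real.norm_of_nonneg htz'.le, dist_eq_norm]
    rw [h2, Real.dist_eq] at h1
    calc F (γ z) - F (γ t) ≤ |F (γ z) - F (γ t)| := le_abs_self _
      _ ≤ _ := h1
      _ = _ := by ring

/-! ### Weak derivatives of Lipschitz functions -/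

namespace SurfaceControl

variable {n : ℕ}

/-- A Lipschitz function has its line derivatives as weak partial derivatives. -/
theorem hasWeakPartialDeriv_lineDeriv (Ω : Set (Space n)) {u : Space n → ℝ} {C : NNReal}
    (hu : LipschitzWith C u) (i : Fin n) :
    HasWeakPartialDeriv Ω i u (fun x => lineDeriv ℝ u x (EuclideanSpace.single i 1)) := by
  refine ⟨hu.continuous.locallyIntegrable.locallyIntegrableOn _,
    (hu.locallyIntegrable_lineDeriv _).locallyIntegrableOn _, fun φ hφ hc hs => ?_⟩
  obtain ⟨D, hD⟩ := ContDiff.lipschitzWith_of_hasCompactSupport hc hφ (by simp)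
  have hz : ∀ x, x ∉ Ω → x ∉ tsupport φ := fun x hx h => hx (hs h)
  -- The support of φ lies in Ω, so both integrals extend to the whole space, where a Lipschitz
  -- function can be integrated by parts against a compactly supported one.
  rw [setIntegral_eq_integral_of_forall_compl_eq_zero (fun x hx => by
      simp [fderiv_of_notMem_tsupport (𝕜 := ℝ) (hz x hx)]),
    setIntegral_eq_integral_of_forall_compl_eq_zero (fun x hx => by
      simp [image_eq_zero_of_notMem_tsupport (hz x hx)]),
    hu.integral_lineDeriv_mul_eq hD hc, ← integral_neg]
  refine integral_congr_ae (Eventually.of_forall fun x => ?_)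
  simp only [(hφ.differentiable (by simp) x).lineDeriv_eq_fderiv, map_neg]
  ring

/-- Weak partial derivatives are unique up to null sets. -/
theorem HasWeakPartialDeriv.ae_eq {Ω : Set (Space n)} (hΩ : IsOpen Ω) {i : Fin n}
    {u g g' : Space n → ℝ} (hg : HasWeakPartialDeriv Ω i u g) (hg' : HasWeakPartialDeriv Ω i u g') :
    g =ᵐ[volume.restrict Ω] g' := by
  have hint : ∀ {f : Space n → ℝ}, LocallyIntegrableOn f Ω volume → ∀ {φ : Space n → ℝ},
      Continuous φ → HasCompactSupport φ → tsupport φ ⊆ Ω →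
      Integrable (fun x => f x * φ x) (volume.restrict Ω) := by
    intro f hf φ hφ hc hs
    have h1 : IntegrableOn (fun x => f x * φ x) (tsupport φ) volume :=
      (hf.integrableOn_compact_subset hs hc).mul_continuousOn hφ.continuousOn hc
    refine Integrable.integrableOn ?_
    rwa [integrableOn_iff_integrable_of_support_subset] at h1
    exact (Function.support_mul_subset_right _ _).trans (subset_tsupport φ)
  have h := hΩ.ae_eq_zero_of_integral_contDiff_smul_eq_zero (μ := volume)
    (f := fun x => g x - g' x) (hg.2.1.sub hg'.2.1) (fun φ hφ hc hs => ?_)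
  · rw [Filter.EventuallyEq, ae_restrict_iff' hΩ.measurableSet]
    filter_upwards [h] with x hx hxΩ using sub_eq_zero.1 (hx hxΩ)
  · rw [← setIntegral_eq_integral_of_forall_compl_eq_zero (s := Ω) (fun x hx => by
      simp [image_eq_zero_of_notMem_tsupport (fun h => hx (hs h))])]
    have h1 := hg.2.2 φ hφ hc hs
    have h2 := hg'.2.2 φ hφ hc hs
    calc ∫ x in Ω, φ x • (g x - g' x) = ∫ x in Ω, (g x * φ x - g' x * φ x) := by
          refine integral_congr_ae (Eventually.of_forall fun x => ?_)
          simp only [smul_eq_mul]; ring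
      _ = (∫ x in Ω, g x * φ x) - ∫ x in Ω, g' x * φ x :=
          integral_sub (hint hg.2.1 hφ.continuous hc hs) (hint hg'.2.1 hφ.continuous hc hs)
      _ = 0 := by linarith

theorem weakPartial_ae_eq_lineDeriv {Ω : Set (Space n)} (hΩ : IsOpen Ω) {u : Space n → ℝ}
    {C : NNReal} (hu : LipschitzWith C u) (i : Fin n) :
    weakPartial Ω i u =ᵐ[volume.restrict Ω]
      fun x => lineDeriv ℝ u x (EuclideanSpace.single i 1) := by
  have h : ∃ g, HasWeakPartialDeriv Ω i u g := ⟨_, hasWeakPartialDeriv_lineDeriv Ω hu i⟩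
  rw [weakPartial, dif_pos h]
  exact h.choose_spec.ae_eq hΩ (hasWeakPartialDeriv_lineDeriv Ω hu i)

/-- A compactly supported Lipschitz function whose `i`-th partial derivative vanishes almost
everywhere on its support is zero. -/
theorem eq_zero_of_lineDeriv_ae_eq_zero {u : Space n → ℝ} {C : NNReal} (hu : LipschitzWith C u)
    (hc : HasCompactSupport u) (i : Fin n)
    (h : ∀ᵐ x, u x ≠ 0 → lineDeriv ℝ u x (EuclideanSpace.single i 1) = 0) : u = 0 := by
  set e : Space n := EuclideanSpace.single i 1
  obtain ⟨M, hM⟩ := hc.exists_bound_of_continuous hu.continuous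
  have hMx : ∀ x, |u x| ≤ M.toNNReal := fun x =>
    (hM x).trans (Real.le_coe_toNNReal M)
  have hsq : LipschitzWith (2 * M.toNNReal * C) (fun x => u x * u x) := by
    refine LipschitzWith.of_dist_le_mul fun x y => ?_
    have h1 := hu.dist_le_mul x y
    rw [Real.dist_eq] at h1 ⊢
    rw [mul_self_sub_mul_self, abs_mul]
    have h2 : |u x + u y| ≤ 2 * M.toNNReal := by
      linarith [abs_add_le (u x) (u y), hMx x, hMx y]
    push_cast
    calc _ ≤ (2 * (M.toNNReal : ℝ)) * (C * dist x y) := by gcongr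
      _ = _ := by ring
  have hcsq : HasCompactSupport (fun x => u x * u x) := hc.mul_right
  have hlin : LipschitzWith 1 (fun x : Space n => x i) := by
    refine LipschitzWith.of_dist_le_mul fun x y => ?_
    simpa [Real.dist_eq, dist_eq_norm] using PiLp.norm_apply_le (x - y) i
  -- Integrating ∂ᵢ(xᵢ) · u² by parts gives ∫ u² = -∫ xᵢ · 2u ∂ᵢu, and the right side vanishes by
  -- hypothesis. This replaces a Poincaré inequality.
  have hparts := hlin.integral_lineDeriv_mul_eq (μ := volume) hsq hcsq e
  have hleft : ∀ x : Space n, lineDeriv ℝ (fun x : Space n => x i) x e = 1 := by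
    intro x
    have : HasLineDerivAt ℝ (fun x : Space n => x i) 1 x e := by
      have := ((hasDerivAt_id (0 : ℝ)).const_add (x i))
      simpa [HasLineDerivAt, e] using this
    exact this.lineDeriv
  have hright : ∀ᵐ x, lineDeriv ℝ (fun x => u x * u x) x (-e) * x i = 0 := by
    filter_upwards [h, hu.ae_lineDifferentiableAt e] with x hx hdx
    have h1 : HasLineDerivAt ℝ (fun x => u x * u x) (2 * (u x * lineDeriv ℝ u x e)) x e := by
      have h2 := hdx.hasLineDerivAt
      unfold HasLineDerivAt at h2 ⊢
      have h3 := h2.mul h2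
      simp only [zero_smul, add_zero] at h3
      exact h3.congr_deriv (by ring)
    rw [lineDeriv_neg, h1.lineDeriv]
    by_cases h0 : u x = 0
    · simp [h0]
    · simp [hx h0]
  rw [integral_congr_ae hright] at hparts
  simp only [hleft, one_mul, integral_zero] at hparts
  by_contra hne
  obtain ⟨x, hx⟩ := Function.ne_iff.1 hne
  exact (Continuous.integral_pos_of_hasCompactSupport_nonneg_nonzero (μ := volume)
    hsq.continuous hcsq (fun x => mul_self_nonneg _) (x := x) (mul_ne_zero hx hx)).ne' hparts

end SurfaceControl

/-! ### Abstract minimisation and finite-dimensional duality -/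

/-- A continuous uniformly midpoint convex function that is nonnegative has a unique minimiser on a
nonempty closed convex subset of a complete space. -/
theorem existsUnique_isMinimiser_of_uniformly_midconvex {H : Type*} [NormedAddCommGroup H]
    [NormedSpace ℝ H] [CompleteSpace H] {U : Set H} (hne : U.Nonempty) (hcl : IsClosed U)
    (hconv : Convex ℝ U) {J : H → ℝ} (hJ : Continuous J) (hnonneg : ∀ x, 0 ≤ J x) {c : ℝ}
    (hc : 0 < c)
    (hmid : ∀ x y, J (midpoint ℝ x y) ≤ (J x + J y) / 2 - c * ‖x - y‖ ^ 2) :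
    ∃! u, SurfaceControl.IsMinimiser J U u := by
  have hbdd : BddBelow (J '' U) := ⟨0, by rintro _ ⟨x, -, rfl⟩; exact hnonneg x⟩
  set I := sInf (J '' U)
  have hI : ∀ x ∈ U, I ≤ J x := fun x hx => csInf_le hbdd (mem_image_of_mem J hx)
  have hmidU : ∀ x ∈ U, ∀ y ∈ U, midpoint ℝ x y ∈ U := fun x hx y hy =>
    hconv.midpoint_mem hx hy
  -- The midpoint is admissible, so its value is at least the infimum. Hence two points of small
  -- excess are close, which yields both the Cauchy property and uniqueness.
  have hdist : ∀ x ∈ U, ∀ y ∈ U, c * ‖x - y‖ ^ 2 ≤ ((J x - I) + (J y - I)) / 2 := by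
    intro x hx y hy
    linarith [hmid x y, hI _ (hmidU x hx y hy)]
  have hseq : ∀ k : ℕ, ∃ x ∈ U, J x < I + 1 / ((k : ℝ) + 1) := by
    intro k
    obtain ⟨_, ⟨x, hx, rfl⟩, hlt⟩ := exists_lt_of_csInf_lt (hne.image J)
      (lt_add_of_pos_right I (Nat.one_div_pos_of_nat (α := ℝ) (n := k)))
    exact ⟨x, hx, hlt⟩
  choose x hxU hxlt using hseq
  have hJlim : Tendsto (fun k => J (x k)) atTop (𝓝 I) := by
    refine tendsto_of_tendsto_of_tendsto_of_le_of_le tendsto_const_nhds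
      (h := fun k : ℕ => I + 1 / ((k : ℝ) + 1)) ?_ (fun k => hI _ (hxU k)) (fun k => (hxlt k).le)
    simpa using tendsto_const_nhds.add (tendsto_one_div_add_atTop_nhds_zero_nat (𝕜 := ℝ))
  have hcau : CauchySeq x := by
    rw [Metric.cauchySeq_iff']
    intro ε hε
    have hev : ∀ᶠ k in atTop, J (x k) < I + c * ε ^ 2 :=
      hJlim.eventually (gt_mem_nhds (lt_add_of_pos_right I (by positivity)))
    obtain ⟨N, hN⟩ := eventually_atTop.1 hev
    refine ⟨N, fun k hk => ?_⟩
    have h1 := hdist _ (hxU k) _ (hxU N)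
    have h2 : c * ‖x k - x N‖ ^ 2 < c * ε ^ 2 := by linarith [hN k hk, hN N le_rfl]
    rw [dist_eq_norm]
    exact lt_of_pow_lt_pow_left₀ 2 hε.le (lt_of_mul_lt_mul_left h2 hc.le)
  obtain ⟨u, hu⟩ := cauchySeq_tendsto_of_complete hcau
  have huU : u ∈ U := hcl.mem_of_tendsto hu (Eventually.of_forall hxU)
  have hJu : J u = I := tendsto_nhds_unique ((hJ.tendsto u).comp hu) hJlim
  refine ⟨u, ⟨huU, fun η hη => hJu ▸ hI η hη⟩, fun w ⟨hwU, hw⟩ => ?_⟩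
  have h1 := hdist w hwU u huU
  have h2 : J w ≤ I := hJu ▸ hw u huU
  have h3 : c * ‖w - u‖ ^ 2 ≤ 0 := by linarith
  have h4 : ‖w - u‖ ^ 2 ≤ 0 := nonpos_of_mul_nonpos_right h3 hc
  exact sub_eq_zero.1 (norm_eq_zero.1 (pow_eq_zero_iff two_ne_zero |>.1
    (le_antisymm h4 (sq_nonneg _))))

/-- The variational inequality characterises minimisers of functions with a quadratic expansion
with nonnegative second order part. -/
theorem isMinimiser_iff_of_quadratic_expansion {H : Type*} [AddCommGroup H] [Module ℝ H]
    {U : Set H} (hconv : Convex ℝ U) {J : H → ℝ} {u : H} {D Q : H → ℝ}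
    (hQ : ∀ d, 0 ≤ Q d) (hJ : ∀ (t : ℝ) d, J (u + t • d) = J u + t * D d + t ^ 2 * Q d) :
    SurfaceControl.IsMinimiser J U u ↔ u ∈ U ∧ ∀ v ∈ U, 0 ≤ D (v - u) := by
  refine and_congr_right fun huU => ⟨fun h v hv => ?_, fun h v hv => ?_⟩
  · by_contra! hneg
    set d := v - u
    -- This is the difference quotient (J(u + t d) - J(u)) / t; if its limit were negative, a short
    -- step towards v would decrease J.
    have hlim : Tendsto (fun t : ℝ => D d + t * Q d) (𝓝[>] 0) (𝓝 (D d)) := by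
      have : Continuous fun t : ℝ => D d + t * Q d := by fun_prop
      simpa using (this.tendsto 0).mono_left (nhdsWithin_le_nhds (s := Ioi 0))
    obtain ⟨t, htneg, ht0, ht1⟩ := ((hlim.eventually (gt_mem_nhds hneg)).and
      (Ioo_mem_nhdsGT (zero_lt_one' ℝ))).exists
    have hmem : u + t • d ∈ U := hconv.add_smul_sub_mem huU hv ⟨ht0.le, ht1.le⟩
    have h1 := h _ hmem
    rw [hJ] at h1
    nlinarith
  · have h1 := hJ 1 (v - u)
    simp only [one_smul, add_sub_cancel, one_mul, one_pow] at h1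
    rw [h1]
    linarith [h v hv, hQ (v - u)]

/-- A positive definite bilinear form on a finite-dimensional space represents every functional by
a unique first argument. -/
theorem existsUnique_of_posDef {V : Type*} [AddCommGroup V] [Module ℝ V] [FiniteDimensional ℝ V]
    {B : V →ₗ[ℝ] V →ₗ[ℝ] ℝ} (hpos : ∀ v, v ≠ 0 → 0 < B v v) (ℓ : V →ₗ[ℝ] ℝ) :
    ∃! y, B y = ℓ := by
  have hinj : Function.Injective B := by
    rw [← LinearMap.ker_eq_bot, LinearMap.ker_eq_bot']
    intro v hv
    by_contra h
    simpa [hv] using hpos v h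
  have hsurj : Function.Surjective B :=
    (LinearMap.injective_iff_surjective_of_finrank_eq_finrank
      (Subspace.dual_finrank_eq (K := ℝ) (V := V)).symm).1 hinj
  obtain ⟨y, hy⟩ := hsurj ℓ
  exact ⟨y, hy, fun z hz => hinj (hz.trans hy.symm)⟩

/-! ### The abstract quadratic control problem -/

section QuadraticControl

variable {H V X : Type*} [NormedAddCommGroup H] [InnerProductSpace ℝ H]
  [AddCommGroup V] [Module ℝ V] [FiniteDimensional ℝ V] [AddCommGroup X] [Module ℝ X]
  {B : V →ₗ[ℝ] V →ₗ[ℝ] ℝ} {ι : V →ₗ[ℝ] H} {S : H → V}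

theorem galerkin_isLinearMap (hpos : ∀ v, v ≠ 0 → 0 < B v v)
    (hS : ∀ η v, B (S η) v = inner ℝ η (ι v)) : IsLinearMap ℝ S := by
  have hinj : ∀ y z : V, (∀ v, B y v = B z v) → y = z := fun y z h =>
    (existsUnique_of_posDef hpos (B z)).unique (LinearMap.ext h) rfl
  constructor
  · intro η ζ
    exact hinj _ _ fun v => by simp [hS, inner_add_left]
  · intro c η
    exact hinj _ _ fun v => by simp [hS, inner_smul_left]

/-- Linear functionals composed with the Galerkin operator are continuous. -/
theorem galerkin_continuous (hpos : ∀ v, v ≠ 0 → 0 < B v v) (hsymm : ∀ v w, B v w = B w v)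
    (hS : ∀ η v, B (S η) v = inner ℝ η (ι v)) (ℓ : V →ₗ[ℝ] ℝ) : Continuous fun η => ℓ (S η) := by
  -- With ℓ = B(z, ·), symmetry gives ℓ(Sη) = B(Sη, z) = (η, ιz). Continuity thus comes from `H`,
  -- and `V` needs no topology.
  obtain ⟨z, hz, -⟩ := existsUnique_of_posDef hpos ℓ
  have : (fun η => ℓ (S η)) = fun η => inner ℝ η (ι z) := by
    ext η
    rw [← hS, ← hz, hsymm]
  rw [this]
  fun_prop

/-- Expanding one argument in a basis of `V` leaves a finite sum of products of continuous
functionals. This is why the observation form `m` may be discontinuous. -/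
theorem galerkin_continuous_bilin (hpos : ∀ v, v ≠ 0 → 0 < B v v) (hsymm : ∀ v w, B v w = B w v)
    (hS : ∀ η v, B (S η) v = inner ℝ η (ι v)) (q : V →ₗ[ℝ] V →ₗ[ℝ] ℝ) :
    Continuous fun η => q (S η) (S η) := by
  let b := Module.finBasis ℝ V
  have : (fun η => q (S η) (S η)) = fun η => ∑ k, b.coord k (S η) * q (b k) (S η) := by
    ext η
    conv_lhs => enter [1]; rw [← b.sum_repr (S η), map_sum]
    simp [LinearMap.sum_apply]
  rw [this]
  exact continuous_finsetSum _ fun k _ => (galerkin_continuous hpos hsymm hS _).mul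
    (galerkin_continuous hpos hsymm hS _)

variable {m : X →ₗ[ℝ] X →ₗ[ℝ] ℝ} {R : V →ₗ[ℝ] X} {g : X} {ν : ℝ} {J : H → ℝ}

/-- `S` and `R` are linear, so the objective is exactly quadratic along lines. The same identity
serves for convexity and for the derivative. -/
theorem objective_expansion (hpos : ∀ v, v ≠ 0 → 0 < B v v)
    (hS : ∀ η v, B (S η) v = inner ℝ η (ι v)) (hm : SurfaceControl.IsInnerProduct m)
    (hJ : ∀ η, J η = 1 / 2 * m (R (S η) - g) (R (S η) - g) + ν / 2 * ‖η‖ ^ 2) (u : H) (t : ℝ)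
    (d : H) :
    J (u + t • d) = J u + t * (m (R (S u) - g) (R (S d)) + ν * inner ℝ u d) +
      t ^ 2 * (1 / 2 * m (R (S d)) (R (S d)) + ν / 2 * ‖d‖ ^ 2) := by
  have hlin := galerkin_isLinearMap hpos hS
  have h1 : R (S (u + t • d)) - g = (R (S u) - g) + t • R (S d) := by
    rw [hlin.map_add, hlin.map_smul, map_add, map_smul]; abel
  rw [hJ, hJ, h1, norm_add_sq_real, inner_smul_right, norm_smul, mul_pow, Real.norm_eq_abs, sq_abs]
  simp only [map_add, LinearMap.add_apply, map_smul, LinearMap.smul_apply, smul_eq_mul]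
  rw [hm.symm (R (S d)) (R (S u) - g)]
  ring

theorem isInnerProduct_self_nonneg (hm : SurfaceControl.IsInnerProduct m) (w : X) : 0 ≤ m w w := by
  by_cases h : w = 0
  · simp [h]
  · exact (hm.pos w h).le

theorem existsUnique_optimal_control [CompleteSpace H] {U : Set H} (hne : U.Nonempty)
    (hcl : IsClosed U) (hconv : Convex ℝ U) (hpos : ∀ v, v ≠ 0 → 0 < B v v)
    (hsymm : ∀ v w, B v w = B w v)
    (hS : ∀ η v, B (S η) v = inner ℝ η (ι v)) (hm : SurfaceControl.IsInnerProduct m) (hν : 0 < ν)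
    (hJ : ∀ η, J η = 1 / 2 * m (R (S η) - g) (R (S η) - g) + ν / 2 * ‖η‖ ^ 2) :
    ∃! u, SurfaceControl.IsMinimiser J U u := by
  refine existsUnique_isMinimiser_of_uniformly_midconvex hne hcl hconv ?_ ?_
    (c := ν / 8) (by positivity) ?_
  · have : J = fun η => 1 / 2 * (m.compl₁₂ R R (S η) (S η) - 2 * (m g ∘ₗ R) (S η) + m g g) +
        ν / 2 * ‖η‖ ^ 2 := by
      ext η
      rw [hJ]
      simp only [map_sub, LinearMap.sub_apply, LinearMap.compl₁₂_apply, LinearMap.comp_apply]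
      rw [hm.symm (R (S η)) g]
      ring
    rw [this]
    have h1 := galerkin_continuous_bilin hpos hsymm hS (m.compl₁₂ R R)
    have h2 := galerkin_continuous hpos hsymm hS (m g ∘ₗ R)
    fun_prop
  · intro η
    have := isInnerProduct_self_nonneg hm (R (S η) - g)
    rw [hJ]
    positivity
  · intro x y
    -- If Q is the second-order coefficient, the expansions at t = 1/2 and t = 1 give (J x + J y)/2
    -- - J(midpoint) = Q/2 - Q/4 = Q/4. Since Q ≥ (ν/2)‖y - x‖², the constant is ν/8.
    have h1 := objective_expansion hpos hS hm hJ x (1 / 2) (y - x)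
    have h2 := objective_expansion hpos hS hm hJ x 1 (y - x)
    have h3 : midpoint ℝ x y = x + (1 / 2 : ℝ) • (y - x) := by
      rw [midpoint, AffineMap.lineMap_apply_module']; simp [add_comm]
    rw [← h3] at h1
    simp only [one_smul, add_sub_cancel] at h2
    have h4 := isInnerProduct_self_nonneg hm (R (S (y - x)))
    rw [norm_sub_rev x y, h1, h2]
    linarith

/-- Testing the adjoint equation with v = S d gives m(R S u - g, R S d) = B(S d, p) = (d, ι p). So
the directional derivative of J at u is represented by ι p + ν u, and p exists by duality on `V`. -/
theorem optimal_control_iff {U : Set H} (hconv : Convex ℝ U) (hpos : ∀ v, v ≠ 0 → 0 < B v v)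
    (hsymm : ∀ v w, B v w = B w v)
    (hS : ∀ η v, B (S η) v = inner ℝ η (ι v)) (hm : SurfaceControl.IsInnerProduct m) (hν : 0 < ν)
    (hJ : ∀ η, J η = 1 / 2 * m (R (S η) - g) (R (S η) - g) + ν / 2 * ‖η‖ ^ 2) (u : H) :
    SurfaceControl.IsMinimiser J U u ↔
      ∃ p : V, (u ∈ U ∧ ∀ v ∈ U, 0 ≤ inner ℝ (ι p + ν • u) (v - u)) ∧
        ∀ v, B v p = m (R (S u) - g) (R v) := by
  have hD : ∀ p : V, (∀ v, B v p = m (R (S u) - g) (R v)) → ∀ d : H,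
      inner ℝ (ι p + ν • u) d = m (R (S u) - g) (R (S d)) + ν * inner ℝ u d := by
    intro p hp d
    rw [inner_add_left, inner_smul_left, ← hp, hS, real_inner_comm d (ι p)]
    rfl
  rw [isMinimiser_iff_of_quadratic_expansion hconv
    (D := fun d => m (R (S u) - g) (R (S d)) + ν * inner ℝ u d)
    (Q := fun d => 1 / 2 * m (R (S d)) (R (S d)) + ν / 2 * ‖d‖ ^ 2)
    (fun d => by have := isInnerProduct_self_nonneg hm (R (S d)); positivity)
    (objective_expansion hpos hS hm hJ u)]
  constructor
  · rintro ⟨hu, h⟩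
    obtain ⟨p, hp, -⟩ := existsUnique_of_posDef hpos (m (R (S u) - g) ∘ₗ R)
    have hp' : ∀ v, B v p = m (R (S u) - g) (R v) := fun v => by rw [hsymm, hp]; rfl
    exact ⟨p, ⟨hu, fun v hv => by rw [hD p hp']; exact h v hv⟩, hp'⟩
  · rintro ⟨p, ⟨hu, h⟩, hp⟩
    exact ⟨hu, fun v hv => by have := h v hv; rwa [hD p hp] at this⟩

end QuadraticControl

/-! ### The finite element space and the elliptic form -/

namespace SurfaceControl

variable {n : ℕ} {Ω : Set (Space n)} {K : Geometry.SimplicialComplex ℝ (Space n)}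

/-- Outside the elements of a triangulation finite element functions vanish. -/
theorem feSpace_eq_zero_or_mem_convexHull (hK : IsTriangulation Ω K) {v : Space n → ℝ}
    (hv : v ∈ feSpace Ω K) (x : Space n) :
    v x = 0 ∨ ∃ t ∈ K.faces, t.card = n + 1 ∧ x ∈ convexHull ℝ (t : Set (Space n)) := by
  by_cases hx : x ∈ Ω
  · by_cases hxP : x ∈ polyDomain K
    · obtain ⟨s, hs, hxs⟩ := Geometry.SimplicialComplex.mem_space_iff.1 (interior_subset hxP)
      obtain ⟨t, ht, hst, htc⟩ := hK.pure s hs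
      exact Or.inr ⟨t, ht, htc, convexHull_mono (by exact_mod_cast hst) hxs⟩
    · exact Or.inl (hv.2.2.1 x ⟨hx, hxP⟩)
  · exact Or.inl (hv.2.1 x hx)

/-- The zero set and the full-dimensional simplices form a finite closed cover. The function is
constant on the former and affine on each of the latter. -/
theorem exists_lipschitzWith_of_mem_feSpace (hK : IsTriangulation Ω K) {v : Space n → ℝ}
    (hv : v ∈ feSpace Ω K) : ∃ C, LipschitzWith C v := by
  refine lipschitzWith_of_finite_closed_cover hv.1
    (𝒮 := insert {x | v x = 0} ((fun t : Finset (Space n) => convexHull ℝ (t : Set (Space n))) ''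
      {t | t ∈ K.faces ∧ t.card = n + 1})) ?_ ?_ ?_ ?_
  · exact ((hK.finite.subset fun t ht => ht.1).image _).insert _
  · refine eq_univ_of_forall fun x => ?_
    rcases feSpace_eq_zero_or_mem_convexHull hK hv x with h | ⟨t, ht, htc, hx⟩
    · exact mem_sUnion.2 ⟨_, mem_insert _ _, h⟩
    · exact mem_sUnion.2 ⟨_, mem_insert_of_mem _ ⟨t, ⟨ht, htc⟩, rfl⟩, hx⟩
  · rintro s (rfl | ⟨t, -, rfl⟩)
    · exact isClosed_eq hv.1 continuous_const
    · exact (t.finite_toSet.isCompact_convexHull ℝ).isClosed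
  · rintro s (rfl | ⟨t, ⟨ht, htc⟩, rfl⟩)
    · refine ⟨0, LipschitzOnWith.of_dist_le_mul fun x hx y hy => ?_⟩
      simp [show v x = 0 from hx, show v y = 0 from hy]
    · obtain ⟨f, hf⟩ := hv.2.2.2 t ht htc
      let L := LinearMap.toContinuousLinearMap f.linear
      refine ⟨‖L‖₊, LipschitzOnWith.of_dist_le_mul fun x hx y hy => ?_⟩
      rw [hf hx, hf hy, dist_eq_norm, dist_eq_norm, ← vsub_eq_sub, ← AffineMap.linearMap_vsub]
      exact L.le_opNorm (x - y)

theorem hasCompactSupport_of_mem_feSpace (hΩ : Bornology.IsBounded Ω) {v : Space n → ℝ}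
    (hv : v ∈ feSpace Ω K) : HasCompactSupport v :=
  HasCompactSupport.intro hΩ.isCompact_closure fun x hx => hv.2.1 x fun h => hx (subset_closure h)

/-- Finite element functions are determined by their values at the vertices. -/
theorem finiteDimensional_feSpace (hK : IsTriangulation Ω K) :
    FiniteDimensional ℝ (feSpace Ω K) := by
  have : Finite K.vertices := by
    have : K.vertices = (fun x => ({x} : Finset (Space n))) ⁻¹' K.faces := rfl
    rw [this]
    exact hK.finite.preimage (Finset.singleton_injective.injOn)
  let ev : feSpace Ω K →ₗ[ℝ] (K.vertices → ℝ) :=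
    { toFun := fun v x => (v : Space n → ℝ) x
      map_add' := fun _ _ => rfl
      map_smul' := fun _ _ => rfl }
  refine Module.Finite.of_injective ev ?_
  rw [← LinearMap.ker_eq_bot, LinearMap.ker_eq_bot']
  rintro ⟨v, hv⟩ h
  ext x
  change v x = 0
  rcases feSpace_eq_zero_or_mem_convexHull hK hv x with h0 | ⟨t, ht, htc, hx⟩
  · exact h0
  · obtain ⟨f, hf⟩ := hv.2.2.2 t ht htc
    -- An affine map that vanishes at the vertices vanishes on their affine span.
    have hvert : EqOn f (AffineMap.const ℝ (Space n) (0 : ℝ)) (t : Set (Space n)) := by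
      intro y hy
      have hyv : y ∈ K.vertices :=
        K.down_closed ht (Finset.singleton_subset_iff.2 hy) (Finset.singleton_nonempty y)
      rw [← hf (subset_convexHull ℝ _ hy)]
      exact congrFun h ⟨y, hyv⟩
    rw [hf hx]
    exact AffineMap.eqOn_affineSpan hvert (convexHull_subset_affineSpan _ hx)

theorem isFiniteMeasure_restrict (hΩ : Bornology.IsBounded Ω) :
    IsFiniteMeasure (volume.restrict Ω) :=
  ⟨by simpa using hΩ.measure_lt_top⟩

theorem memLp_of_mem_feSpace (hΩ : Bornology.IsBounded Ω) {v : Space n → ℝ}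
    (hv : v ∈ feSpace Ω K) : MemLp v 2 (volume.restrict Ω) :=
  (hv.1.memLp_of_hasCompactSupport (hasCompactSupport_of_mem_feSpace hΩ hv)).restrict Ω

theorem memLp_lineDeriv_of_mem_feSpace (hΩ : Bornology.IsBounded Ω) (hK : IsTriangulation Ω K)
    {v : Space n → ℝ} (hv : v ∈ feSpace Ω K) (e : Space n) :
    MemLp (fun x => lineDeriv ℝ v x e) 2 (volume.restrict Ω) := by
  have := isFiniteMeasure_restrict hΩ
  obtain ⟨C, hC⟩ := exists_lipschitzWith_of_mem_feSpace hK hv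
  exact (hC.memLp_lineDeriv e).mono_exponent le_top

theorem memH1_of_mem_feSpace (hΩ : Bornology.IsBounded Ω) (hK : IsTriangulation Ω K)
    {v : Space n → ℝ} (hv : v ∈ feSpace Ω K) : MemH1 Ω v := by
  obtain ⟨C, hC⟩ := exists_lipschitzWith_of_mem_feSpace hK hv
  exact ⟨memLp_of_mem_feSpace hΩ hv, fun i =>
    ⟨_, memLp_lineDeriv_of_mem_feSpace hΩ hK hv _, hasWeakPartialDeriv_lineDeriv Ω hC i⟩⟩

/-- The embedding of the finite element space into `L²(Ω)`. -/
noncomputable def feEmbedding (K : Geometry.SimplicialComplex ℝ (Space n))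
    (hΩ : Bornology.IsBounded Ω) : feSpace Ω K →ₗ[ℝ] L2 Ω where
  toFun v := (memLp_of_mem_feSpace hΩ v.2).toLp (v : Space n → ℝ)
  map_add' _ _ := rfl
  map_smul' _ _ := rfl

theorem coeFn_feEmbedding (hΩ : Bornology.IsBounded Ω) (v : feSpace Ω K) :
    feEmbedding K hΩ v =ᵐ[volume.restrict Ω] (v : Space n → ℝ) :=
  MemLp.coeFn_toLp (memLp_of_mem_feSpace hΩ v.2)

/-- The directional derivative as a linear map from the finite element space to `L²(Ω)`. -/
noncomputable def feDeriv (hΩ : Bornology.IsBounded Ω) (hK : IsTriangulation Ω K)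
    (e : Space n) : feSpace Ω K →ₗ[ℝ] L2 Ω where
  toFun v := (memLp_lineDeriv_of_mem_feSpace hΩ hK v.2 e).toLp _
  map_add' v w := by
    obtain ⟨C, hC⟩ := exists_lipschitzWith_of_mem_feSpace hK v.2
    obtain ⟨D, hD⟩ := exists_lipschitzWith_of_mem_feSpace hK w.2
    rw [← MemLp.toLp_add, MemLp.toLp_eq_toLp_iff]
    -- Additivity holds wherever both line derivatives exist, which for Lipschitz functions is
    -- almost everywhere; this suffices for L² classes.
    filter_upwards [ae_restrict_of_ae (hC.ae_lineDifferentiableAt (μ := volume) e),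
      ae_restrict_of_ae (hD.ae_lineDifferentiableAt (μ := volume) e)] with x hx hy
    exact (HasDerivAt.add hx.hasLineDerivAt hy.hasLineDerivAt).deriv
  map_smul' c v := by
    obtain ⟨C, hC⟩ := exists_lipschitzWith_of_mem_feSpace hK v.2
    rw [RingHom.id_apply, ← MemLp.toLp_const_smul, MemLp.toLp_eq_toLp_iff]
    filter_upwards [ae_restrict_of_ae (hC.ae_lineDifferentiableAt (μ := volume) e)] with x hx
    exact (HasDerivAt.const_smul c hx.hasLineDerivAt).deriv

theorem coeFn_feDeriv (hΩ : Bornology.IsBounded Ω) (hK : IsTriangulation Ω K) (e : Space n)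
    (v : feSpace Ω K) :
    feDeriv hΩ hK e v =ᵐ[volume.restrict Ω] fun x => lineDeriv ℝ (v : Space n → ℝ) x e :=
  MemLp.coeFn_toLp (memLp_lineDeriv_of_mem_feSpace hΩ hK v.2 e)

theorem integrable_weighted_mul {α : Type*} [MeasurableSpace α] {μ : Measure α} {M : α → ℝ}
    (hM : MemLp M ⊤ μ) (f g : Lp ℝ 2 μ) : Integrable (fun x => M x * f x * g x) μ :=
  ((Lp.memLp f).mul hM : MemLp _ 2 μ).integrable_mul (Lp.memLp g)

/-- The bilinear form `∫ M f g` on `L²` with a bounded weight `M`. -/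
noncomputable def weightedForm {α : Type*} [MeasurableSpace α] {μ : Measure α} {M : α → ℝ}
    (hM : MemLp M ⊤ μ) : Lp ℝ 2 μ →ₗ[ℝ] Lp ℝ 2 μ →ₗ[ℝ] ℝ :=
  LinearMap.mk₂ ℝ (fun f g => ∫ x, M x * f x * g x ∂μ)
    (fun f f' g => by
      rw [← integral_add (integrable_weighted_mul hM f g) (integrable_weighted_mul hM f' g)]
      refine integral_congr_ae ?_
      filter_upwards [Lp.coeFn_add f f'] with x hx
      rw [hx, Pi.add_apply]; ring)
    (fun c f g => by
      rw [smul_eq_mul, ← integral_const_mul]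
      refine integral_congr_ae ?_
      filter_upwards [Lp.coeFn_smul c f] with x hx
      rw [hx, Pi.smul_apply, smul_eq_mul]; ring)
    (fun f g g' => by
      rw [← integral_add (integrable_weighted_mul hM f g) (integrable_weighted_mul hM f g')]
      refine integral_congr_ae ?_
      filter_upwards [Lp.coeFn_add g g'] with x hx
      rw [hx, Pi.add_apply]; ring)
    (fun c f g => by
      rw [smul_eq_mul, ← integral_const_mul]
      refine integral_congr_ae ?_
      filter_upwards [Lp.coeFn_smul c g] with x hx
      rw [hx, Pi.smul_apply, smul_eq_mul]; ring)

variable {A : Fin n → Fin n → Space n → ℝ} {a₀ : Space n → ℝ}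

theorem IsEllipticCoeff.memLp (hA : IsEllipticCoeff Ω A a₀) (hΩ_open : IsOpen Ω)
    (hΩ : Bornology.IsBounded Ω) (i j : Fin n) : MemLp (A i j) ⊤ (volume.restrict Ω) := by
  obtain ⟨C, hC⟩ := hA.lipschitz i j
  obtain ⟨M, hM⟩ := hΩ.isCompact_closure.exists_bound_of_continuousOn hC.continuousOn
  refine memLp_top_of_bound
    ((hC.continuousOn.mono subset_closure).aestronglyMeasurable hΩ_open.measurableSet) M ?_
  filter_upwards [ae_restrict_mem hΩ_open.measurableSet] with x hx using hM x (subset_closure hx)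

/-- The elliptic form on the finite element space, as a bilinear map. -/
noncomputable def feForm (hΩ_open : IsOpen Ω) (hΩ : Bornology.IsBounded Ω)
    (hK : IsTriangulation Ω K) (hA : IsEllipticCoeff Ω A a₀) :
    feSpace Ω K →ₗ[ℝ] feSpace Ω K →ₗ[ℝ] ℝ :=
  (∑ i, ∑ j, (weightedForm (hA.memLp hΩ_open hΩ i j)).compl₁₂
    (feDeriv hΩ hK (EuclideanSpace.single i 1)) (feDeriv hΩ hK (EuclideanSpace.single j 1))) +
  (weightedForm hA.memLp_zero).compl₁₂ (feEmbedding K hΩ) (feEmbedding K hΩ)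

theorem feForm_apply (hΩ_open : IsOpen Ω) (hΩ : Bornology.IsBounded Ω)
    (hK : IsTriangulation Ω K) (hA : IsEllipticCoeff Ω A a₀) (z v : feSpace Ω K) :
    feForm hΩ_open hΩ hK hA z v =
      (∑ i, ∑ j, ∫ x in Ω, A i j x * feDeriv hΩ hK (EuclideanSpace.single i 1) z x *
        feDeriv hΩ hK (EuclideanSpace.single j 1) v x) +
      ∫ x in Ω, a₀ x * feEmbedding K hΩ z x * feEmbedding K hΩ v x := by
  simp [feForm, LinearMap.sum_apply, weightedForm]

/-- `weakPartial` is an arbitrary choice up to null sets and so not linear pointwise. Passing to L²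
classes of line derivatives makes the form genuinely bilinear. -/
theorem ellipticForm_eq_feForm (hΩ_open : IsOpen Ω) (hΩ : Bornology.IsBounded Ω)
    (hK : IsTriangulation Ω K) (hA : IsEllipticCoeff Ω A a₀) (z v : feSpace Ω K) :
    ellipticForm Ω A a₀ z v = feForm hΩ_open hΩ hK hA z v := by
  have hd : ∀ (w : feSpace Ω K) i, weakPartial Ω i (w : Space n → ℝ) =ᵐ[volume.restrict Ω]
      feDeriv hΩ hK (EuclideanSpace.single i 1) w := fun w i => by
    obtain ⟨C, hC⟩ := exists_lipschitzWith_of_mem_feSpace hK w.2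
    exact (weakPartial_ae_eq_lineDeriv hΩ_open hC i).trans (coeFn_feDeriv hΩ hK _ w).symm
  rw [feForm_apply, ellipticForm]
  congr 1
  · refine Finset.sum_congr rfl fun i _ => Finset.sum_congr rfl fun j _ => integral_congr_ae ?_
    filter_upwards [hd z i, hd v j] with x hx hy
    rw [hx, hy]
  · refine integral_congr_ae ?_
    filter_upwards [coeFn_feEmbedding hΩ z, coeFn_feEmbedding hΩ v] with x hx hy
    rw [hx, hy]

theorem feForm_symm (hΩ_open : IsOpen Ω) (hΩ : Bornology.IsBounded Ω)
    (hK : IsTriangulation Ω K) (hA : IsEllipticCoeff Ω A a₀) (z v : feSpace Ω K) :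
    feForm hΩ_open hΩ hK hA z v = feForm hΩ_open hΩ hK hA v z := by
  rw [feForm_apply, feForm_apply]
  congr 1
  · rw [Finset.sum_comm]
    refine Finset.sum_congr rfl fun i _ => Finset.sum_congr rfl fun j _ => integral_congr_ae ?_
    filter_upwards [ae_restrict_mem hΩ_open.measurableSet] with x hx
    rw [hA.symm j i x (subset_closure hx)]
    ring
  · refine integral_congr_ae (Eventually.of_forall fun x => ?_)
    ring

/-- Ellipticity bounds the principal integrand below by α times the square of any single partial
derivative, and the a₀ term is nonnegative. If the principal integral were zero, the partial
derivative in one fixed direction would vanish a.e. in Ω, forcing v = 0. -/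
theorem feForm_pos (hn : 0 < n) (hΩ_open : IsOpen Ω) (hΩ : Bornology.IsBounded Ω)
    (hK : IsTriangulation Ω K) (hA : IsEllipticCoeff Ω A a₀) (v : feSpace Ω K) (hv : v ≠ 0) :
    0 < feForm hΩ_open hΩ hK hA v v := by
  obtain ⟨C, hC⟩ := exists_lipschitzWith_of_mem_feSpace hK v.2
  obtain ⟨α, hα, hell⟩ := hA.elliptic
  set d : Fin n → L2 Ω := fun i => feDeriv hΩ hK (EuclideanSpace.single i 1) v
  let P : Space n → ℝ := fun x => ∑ i, ∑ j, A i j x * d i x * d j x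
  have hint : ∀ i j, Integrable (fun x => A i j x * d i x * d j x) (volume.restrict Ω) :=
    fun i j => integrable_weighted_mul (hA.memLp hΩ_open hΩ i j) _ _
  have hPint : Integrable P (volume.restrict Ω) :=
    integrable_finsetSum _ fun i _ => integrable_finsetSum _ fun j _ => hint i j
  have hP : ∀ᵐ x ∂(volume.restrict Ω), ∀ i, α * d i x ^ 2 ≤ P x := by
    filter_upwards [ae_restrict_mem hΩ_open.measurableSet] with x hx i
    refine le_trans ?_ (hell x hx (WithLp.toLp 2 fun i => d i x))
    rw [EuclideanSpace.real_norm_sq_eq]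
    gcongr
    exact Finset.single_le_sum (f := fun i => d i x ^ 2) (fun j _ => sq_nonneg _)
      (Finset.mem_univ i)
  let i₀ : Fin n := ⟨0, hn⟩
  have hP0 : 0 ≤ᵐ[volume.restrict Ω] P := by
    filter_upwards [hP] with x hx using le_trans (by positivity) (hx i₀)
  have hzero : 0 ≤ ∫ x in Ω, a₀ x * feEmbedding K hΩ v x * feEmbedding K hΩ v x := by
    refine integral_nonneg_of_ae ?_
    filter_upwards [hA.nonneg_zero] with x hx
    rw [mul_assoc]
    exact mul_nonneg hx (mul_self_nonneg _)
  have hsum : feForm hΩ_open hΩ hK hA v v = (∫ x in Ω, P x) +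
      ∫ x in Ω, a₀ x * feEmbedding K hΩ v x * feEmbedding K hΩ v x := by
    rw [feForm_apply, integral_finsetSum _
      fun i _ => integrable_finsetSum _ fun j _ => hint i j]
    congr 1
    exact Finset.sum_congr rfl fun i _ => (integral_finsetSum _ fun j _ => hint i j).symm
  have hPpos : 0 < ∫ x in Ω, P x := by
    refine (integral_nonneg_of_ae hP0).lt_of_ne' fun h0 => hv ?_
    rw [integral_eq_zero_iff_of_nonneg_ae hP0 hPint] at h0
    have hd0 : ∀ᵐ x ∂(volume.restrict Ω),
        lineDeriv ℝ (v : Space n → ℝ) x (EuclideanSpace.single i₀ 1) = 0 := by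
      filter_upwards [h0, hP, coeFn_feDeriv hΩ hK (EuclideanSpace.single i₀ 1) v] with x hx hxP hxd
      have h1 := hxP i₀
      rw [hx, Pi.zero_apply] at h1
      have h2 := nonpos_of_mul_nonpos_right h1 hα
      rw [← hxd]
      exact pow_eq_zero_iff two_ne_zero |>.1 (le_antisymm h2 (sq_nonneg _))
    rw [ae_restrict_iff' hΩ_open.measurableSet] at hd0
    refine Subtype.ext (eq_zero_of_lineDeriv_ae_eq_zero hC
      (hasCompactSupport_of_mem_feSpace hΩ v.2) i₀ ?_)
    filter_upwards [hd0] with x hx hvx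
    -- The derivative is known to vanish only in Ω, but v is nonzero only there.
    exact hx (by by_contra h; exact hvx (v.2.2.1 x h))
  rw [hsum]
  linarith

end SurfaceControl

/-! ### The admissible set -/

namespace SurfaceControl

variable {n : ℕ} {Ω : Set (Space n)} {K : Geometry.SimplicialComplex ℝ (Space n)}

theorem inner_L2 (f g : L2 Ω) : inner ℝ f g = ∫ x in Ω, f x * g x := by
  rw [L2.inner_def]
  refine integral_congr_ae (Eventually.of_forall fun x => ?_)
  simp [mul_comm]

theorem mem_admissible {a b : EReal} {η : L2 Ω} : η ∈ admissible Ω a b ↔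
    ∀ᵐ x ∂(volume.restrict Ω), a ≤ ((η x : ℝ) : EReal) ∧ ((η x : ℝ) : EReal) ≤ b :=
  Iff.rfl

theorem convex_admissible (a b : EReal) : Convex ℝ (admissible Ω a b) := by
  intro η hη ζ hζ s t hs ht hst
  rw [mem_admissible] at *
  filter_upwards [hη, hζ, Lp.coeFn_add (s • η) (t • ζ), Lp.coeFn_smul s η,
    Lp.coeFn_smul t ζ] with x hx hy h1 h2 h3
  rw [h1, Pi.add_apply, h2, h3, Pi.smul_apply, Pi.smul_apply]
  -- The reals between extended bounds form an order-connected, hence convex, set; this treats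
  -- finite and infinite bounds at once.
  have hord : ((fun r : ℝ => (r : EReal)) ⁻¹' Icc a b).OrdConnected :=
    ordConnected_Icc.preimage_mono fun _ _ h => EReal.coe_le_coe h
  exact hord.convex hx hy hs ht hst

/-- For finite bounds, constants are in L² because Ω has finite measure, and closedness becomes that
of an order interval in `Lp`. -/
theorem admissible_coe_eq_Icc (hΩ : Bornology.IsBounded Ω) (r s : ℝ) :
    haveI := isFiniteMeasure_restrict hΩ
    admissible Ω (r : EReal) (s : EReal) =
      Icc (Lp.const 2 (volume.restrict Ω) r) (Lp.const 2 (volume.restrict Ω) s) := by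
  have := isFiniteMeasure_restrict hΩ
  ext η
  rw [mem_admissible, mem_Icc, ← Lp.coeFn_le, ← Lp.coeFn_le, Filter.EventuallyLE, Filter.EventuallyLE,
    ← eventually_and]
  refine eventually_congr ?_
  filter_upwards [Lp.coeFn_const 2 (volume.restrict Ω) r,
    Lp.coeFn_const 2 (volume.restrict Ω) s] with x h1 h2
  rw [h1, h2]
  simp

theorem admissible_bot_top : admissible Ω ⊥ ⊤ = univ :=
  eq_univ_of_forall fun _ => mem_admissible.2 <| Eventually.of_forall fun _ => ⟨bot_le, le_top⟩

theorem isClosed_and_nonempty_admissible (hΩ : Bornology.IsBounded Ω) {a b : EReal}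
    (hab : (∃ r s : ℝ, r < s ∧ a = (r : EReal) ∧ b = (s : EReal)) ∨ (a = ⊥ ∧ b = ⊤)) :
    IsClosed (admissible Ω a b) ∧ (admissible Ω a b).Nonempty := by
  have := isFiniteMeasure_restrict hΩ
  rcases hab with ⟨r, s, hrs, rfl, rfl⟩ | ⟨rfl, rfl⟩
  · rw [admissible_coe_eq_Icc hΩ]
    refine ⟨isClosed_Icc, nonempty_Icc.2 ?_⟩
    rw [← Lp.coeFn_le]
    filter_upwards [Lp.coeFn_const 2 (volume.restrict Ω) r,
      Lp.coeFn_const 2 (volume.restrict Ω) s] with x h1 h2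
    rw [h1, h2]
    exact hrs.le
  · rw [admissible_bot_top]
    exact ⟨isClosed_univ, univ_nonempty⟩

end SurfaceControl

/-! ### Applying the abstract results to the discrete problem -/

theorem mainTheorem5 (n : ℕ) (hn : n = 2 ∨ n = 3)
    (Ω : Set (SurfaceControl.Space n)) (hΩ_open : IsOpen Ω) (hΩ : Bornology.IsBounded Ω)
    (hΩ_convex : Convex ℝ Ω)
    (A : Fin n → Fin n → SurfaceControl.Space n → ℝ) (a₀ : SurfaceControl.Space n → ℝ)
    (hA : SurfaceControl.IsEllipticCoeff Ω A a₀)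
    (K : Geometry.SimplicialComplex ℝ (SurfaceControl.Space n))
    (hK : SurfaceControl.IsTriangulation Ω K)
    (Γ : Set (SurfaceControl.Space n)) (hΓ_meas : MeasurableSet Γ) (hΓ_sub : Γ ⊆ Ω)
    (hΓ : Measure.hausdorffMeasure ((n : ℝ) - 1) Γ ≠ ⊤)
    (m : SurfaceControl.L2Surface Γ →ₗ[ℝ] SurfaceControl.L2Surface Γ →ₗ[ℝ] ℝ)
    (hm : SurfaceControl.IsInnerProduct m) (g : SurfaceControl.L2Surface Γ)
    (a b : EReal)
    (hab : (∃ r s : ℝ, r < s ∧ a = (r : EReal) ∧ b = (s : EReal)) ∨ (a = ⊥ ∧ b = ⊤))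
    (ν : ℝ) (hν : 0 < ν) :
    -- the bilinear form is meaningful on `V_h` and the operator `S_h` is well defined
    (∀ v ∈ SurfaceControl.feSpace Ω K, SurfaceControl.MemH1 Ω v) ∧
    (∀ η : SurfaceControl.L2 Ω,
      SurfaceControl.IsDiscreteState Ω A a₀ K η (SurfaceControl.discreteSolution Ω A a₀ K η) ∧
      ∀ y : SurfaceControl.feSpace Ω K, SurfaceControl.IsDiscreteState Ω A a₀ K η y →
        y = SurfaceControl.discreteSolution Ω A a₀ K η) ∧
    -- unique solvability of the discrete control problem
    (∃! u : SurfaceControl.L2 Ω,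
      SurfaceControl.IsMinimiser (SurfaceControl.objective hΩ A a₀ K hΓ m g ν)
        (SurfaceControl.admissible Ω a b) u) ∧
    -- optimality conditions
    (∀ u : SurfaceControl.L2 Ω,
      SurfaceControl.IsMinimiser (SurfaceControl.objective hΩ A a₀ K hΓ m g ν)
        (SurfaceControl.admissible Ω a b) u ↔
      ∃ p : SurfaceControl.feSpace Ω K,
        (u ∈ SurfaceControl.admissible Ω a b ∧
          ∀ v ∈ SurfaceControl.admissible Ω a b,
            0 ≤ ∫ x in Ω, ((p : SurfaceControl.Space n → ℝ) x + ν * u x) * (v x - u x)) ∧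
        ∀ v : SurfaceControl.feSpace Ω K,
          SurfaceControl.ellipticForm Ω A a₀ (v : SurfaceControl.Space n → ℝ)
              (p : SurfaceControl.Space n → ℝ) =
            m (SurfaceControl.surfaceRestrict hΩ K hΓ
                  (SurfaceControl.discreteSolution Ω A a₀ K u) - g)
              (SurfaceControl.surfaceRestrict hΩ K hΓ v)) := by
  have hn0 : 0 < n := by omega
  have hfin := SurfaceControl.finiteDimensional_feSpace hK
  have hpos := SurfaceControl.feForm_pos hn0 hΩ_open hΩ hK hA
  have hsymm := SurfaceControl.feForm_symm hΩ_open hΩ hK hA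
  obtain ⟨hcl, hne⟩ := SurfaceControl.isClosed_and_nonempty_admissible hΩ hab
  have hconv := SurfaceControl.convex_admissible (Ω := Ω) a b
  set B := SurfaceControl.feForm hΩ_open hΩ hK hA
  set ι := SurfaceControl.feEmbedding K hΩ
  have hload : ∀ (η : SurfaceControl.L2 Ω) (v : SurfaceControl.feSpace Ω K),
      ∫ x in Ω, η x * (v : SurfaceControl.Space n → ℝ) x = inner ℝ η (ι v) := by
    intro η v
    rw [SurfaceControl.inner_L2]
    refine integral_congr_ae ?_
    filter_upwards [SurfaceControl.coeFn_feEmbedding hΩ v] with x hx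
    rw [hx]
  -- The Galerkin equations as one equality of functionals on `V_h`, the form to which duality
  -- applies.
  have hstate : ∀ η y, SurfaceControl.IsDiscreteState Ω A a₀ K η y ↔
      B y = (innerSL ℝ η).toLinearMap ∘ₗ ι := by
    intro η y
    rw [LinearMap.ext_iff]
    refine forall_congr' fun v => ?_
    rw [SurfaceControl.ellipticForm_eq_feForm hΩ_open hΩ hK hA, hload]
    rfl
  have hS : ∀ η, SurfaceControl.IsDiscreteState Ω A a₀ K η
      (SurfaceControl.discreteSolution Ω A a₀ K η) := fun η =>
    -- The choice in `discreteSolution` is meaningful only once existence is known, which positive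
    -- definiteness supplies.
    Classical.epsilon_spec ((existsUnique_of_posDef hpos _).exists.imp fun y => (hstate η y).2)
  have hS' : ∀ η v, B (SurfaceControl.discreteSolution Ω A a₀ K η) v = inner ℝ η (ι v) :=
    fun η v => by rw [(hstate η _).1 (hS η)]; rfl
  have hJ : ∀ η, SurfaceControl.objective hΩ A a₀ K hΓ m g ν η =
      1 / 2 * m (SurfaceControl.surfaceRestrict hΩ K hΓ
          (SurfaceControl.discreteSolution Ω A a₀ K η) - g)
        (SurfaceControl.surfaceRestrict hΩ K hΓ
          (SurfaceControl.discreteSolution Ω A a₀ K η) - g) + ν / 2 * ‖η‖ ^ 2 := fun η => by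
    rw [SurfaceControl.objective, SurfaceControl.formNorm,
      Real.sq_sqrt (isInnerProduct_self_nonneg hm _)]
  refine ⟨fun v hv => SurfaceControl.memH1_of_mem_feSpace hΩ hK hv, fun η => ⟨hS η, fun y hy =>
    (existsUnique_of_posDef hpos _).unique ((hstate η y).1 hy) ((hstate η _).1 (hS η))⟩,
    existsUnique_optimal_control hne hcl hconv hpos hsymm hS' hm hν hJ, fun u => ?_⟩
  rw [optimal_control_iff hconv hpos hsymm hS' hm hν hJ u]
  refine exists_congr fun p => and_congr (and_congr_right fun _ => forall₂_congr fun v _ => ?_)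
    (forall_congr' fun v => ?_)
  · rw [SurfaceControl.inner_L2]
    refine iff_of_eq (congrArg (0 ≤ ·) (integral_congr_ae ?_))
    filter_upwards [SurfaceControl.coeFn_feEmbedding hΩ p, Lp.coeFn_add (ι p) (ν • u),
      Lp.coeFn_smul ν u, Lp.coeFn_sub v u] with x h1 h2 h3 h4
    rw [h4, h2, Pi.add_apply, Pi.sub_apply, h3, h1, Pi.smul_apply, smul_eq_mul]
  · rw [SurfaceControl.ellipticForm_eq_feForm hΩ_open hΩ hK hA]
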